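/- Let $Z$ be a finite planar bipartite multigraph (parallel edges allowed) with black vertices $b_1,\dots,b_n$, white vertices $w_1,\dots,w_n$ and edge set $E$, given with an embedding in the sphere. The number of sides of a face is the length of its boundary walk, so an edge having the same face on both of its sides counts as two sides of that face. A signing $s:E\to\{+1,-1\}$ is called flat if every face with $4k$ sides has an odd number of negative sides and every face with $4k+2$ sides has an even number of negative sides (all faces are meant, including the one that becomes the outside face in the plane; if $Z$ is disconnected, the condition is imposed on each boundary walk of each face separately). For a weighting $w:E\to R$ with values in a commutative ring $R$, let $M_{Z_w}$ be the $n\times n$ matrix whose $(i,j)$ entry is the total weight of all edges from $b_i$ to $w_j$. Let $s$ be a flat signing of $Z$. For an arbitrary weighting $w$, let $Z_{w'}$ be the graph $Z$ with the product weighting $w'(e)=s(e)\,w(e)$. Then $$\operatorname{Det}(M_{Z_{w'}})=\pm\operatorname{Per}(M_{Z_w}).$$ Moreover the equality holds term by term: there is a sign $\varepsilon\in\{+1,-1\}$, depending only on $Z$, its embedding and $s$, such that $\operatorname{Det}(M_{Z_{w'}})=\varepsilon\operatorname{Per}(M_{Z_w})$ for every commutative ring $R$ and every weighting $w$, and such that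 for every perfect matching $m\subseteq E$ of $Z$, with $\sigma\in S_n$ the permutation for which the edge of $m$ at $b_i$ ends at $w_{\sigma(i)}$, one has $\operatorname{sgn}(\sigma)\prod_{e\in m}s(e)=\varepsilon$. -/

import Mathlib

/-- A bipartite multigraph with black vertices `b_i` and white vertices `w_j`, where `i` and `j` run
over `Fin n`, and with edge set `E`; parallel edges are allowed. The edge `e` joins
`b_(black e)` to `w_(white e)`. -/
structure BipartiteGraph (n : ℕ) (E : Type*) where
  /-- the black end of an edge -/
  black : E → Fin n
  /-- the white end of an edge -/
  white : E → Fin n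

namespace BipartiteGraph

variable {n : ℕ} {E : Type*}

/-- Oriented edges: `(e, false)` is `e` directed from its black end to its white end, and
`(e, true)` is `e` directed from its white end to its black end. -/
abbrev Dart (E : Type*) : Type _ := E × Bool

/-- The vertex from which a dart departs (`Sum.inl i` is `b_i`, `Sum.inr j` is `w_j`). -/
def origin (Z : BipartiteGraph n E) (d : Dart E) : Fin n ⊕ Fin n :=
  if d.2 then Sum.inr (Z.white d.1) else Sum.inl (Z.black d.1)

/-- Reversal of a dart. -/
def reversal (E : Type*) : Equiv.Perm (Dart E) :=
  Equiv.prodCongr (Equiv.refl E) Equiv.boolNot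

/-- The set of cycles (fixed points included) of a permutation of the darts. -/
abbrev Cycles (f : Equiv.Perm (Dart E)) : Type _ :=
  Quotient (Equiv.Perm.SameCycle.setoid f)

/-- An embedding of `Z` in the sphere, as a combinatorial map (rotation system of genus zero):
`next d` is the dart that follows `d` in the counterclockwise order of the darts departing from the
vertex `origin d`. -/
structure PlanarEmbedding (Z : BipartiteGraph n E) where
  /-- the rotation system -/
  next : Equiv.Perm (Dart E)
  /-- the cycles of `next` are exactly the sets of all darts departing from a common vertex -/
  sameCycle_next_iff : ∀ d d' : Dart E, next.SameCycle d d' ↔ Z.origin d = Z.origin d'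
  /-- The surface carrying the map is a sphere (one sphere for each connected component): the
  Euler characteristic, vertices minus edges plus faces, is twice the number of components.
  Isolated vertices have no darts and are counted neither as vertices nor as components here. The
  components are the orbits of the darts under the group generated by `next` and reversal. -/
  euler : (Nat.card (Cycles next) : ℤ) - Nat.card E + Nat.card (Cycles (next * reversal E)) =
    2 * Nat.card (MulAction.orbitRel.Quotient
      (Subgroup.closure ({next, reversal E} : Set (Equiv.Perm (Dart E)))) (Dart E))

namespace PlanarEmbedding

variable {Z : BipartiteGraph n E}

/-- The face permutation: go along the dart to its other end, then depart on the next dart there.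
Each cycle of it traces the boundary walk of a face. -/
def facePerm (P : PlanarEmbedding Z) : Equiv.Perm (Dart E) := P.next * reversal E

/-- The faces of the embedding (for a disconnected graph, the boundary walks of its faces). -/
abbrev Face (P : PlanarEmbedding Z) : Type _ := Cycles P.facePerm

/-- The sides of a face. An edge with the same face on both of its sides gives two sides. -/
def sides (P : PlanarEmbedding Z) (F : P.Face) : Set (Dart E) :=
  {d | (Quotient.mk _ d : P.Face) = F}

/-- The sides of a face that lie on negative edges. -/
def negativeSides (P : PlanarEmbedding Z) (s : E → ℤˣ) (F : P.Face) : Set (Dart E) :=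
  {d ∈ P.sides F | s d.1 = -1}

/-- A signing `s` is flat if each face with `4k` sides has an odd number of negative sides, and each
face with `4k + 2` sides has an even number of negative sides. -/
def IsFlat (P : PlanarEmbedding Z) (s : E → ℤˣ) : Prop :=
  ∀ F : P.Face,
    ((∃ k : ℕ, (P.sides F).ncard = 4 * k) → Odd (P.negativeSides s F).ncard) ∧
    ((∃ k : ℕ, (P.sides F).ncard = 4 * k + 2) → Even (P.negativeSides s F).ncard)

end PlanarEmbedding

/-- The bipartite adjacency matrix of `Z` with edge weights `w`: the `(i, j)` entry is the total
weight of all edges from `b_i` to `w_j`. -/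
def adjMatrix [Fintype E] {R : Type*} [CommRing R] (Z : BipartiteGraph n E) (w : E → R) :
    Matrix (Fin n) (Fin n) R :=
  Matrix.of fun i j => ∑ e with Z.black e = i ∧ Z.white e = j, w e

/-- The product weighting of a signing and a weighting. -/
def signedWeight {R : Type*} [CommRing R] (s : E → ℤˣ) (w : E → R) (e : E) : R :=
  ((s e : ℤ) : R) * w e

/-- A perfect matching: each vertex is an end of exactly one edge of `m`. -/
def IsPerfectMatching (Z : BipartiteGraph n E) (m : Finset E) : Prop :=
  (∀ i : Fin n, ∃! e, e ∈ m ∧ Z.black e = i) ∧ (∀ j : Fin n, ∃! e, e ∈ m ∧ Z.white e = j)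

end BipartiteGraph

/-! Determinant and permanent have the same monomials, one for each perfect matching, so it suffices
that `sgn σ · ∏ s` is the same for any two perfect matchings `m`, `m'` (`IsFlat.sign_mul_prod_eq`).
The symmetric difference of `m` and `m'` is a cycle mod 2, hence on the sphere it bounds a set of
faces; let `D` be the set of darts of those faces, cut out by `h = 1`. The sign of the face
permutation on `D` is computed in two ways. By flatness, weighting each side by its sign, and by a
further `-1` if it runs from black to white, gives product `-1` on every face. So the sign is the
product of all these weights. Edges with both sides in `D` cancel, which leaves `(-1)^b · ∏_m s ·
∏_m' s`, where `b` counts the black-to-white darts of `D`. On the other hand, let `x` be the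
involution exchanging the `m`-dart and the `m'`-dart at every vertex. Then `next * reversal = (next
* x) * (x * reversal)`, and both factors preserve `D`. The first is even on `D`
(`sign_next_exchange`); the second has sign `(-1)^b · sgn σ · sgn σ'` (`sign_exchange_reversal`).
Comparing the two results gives the claim. -/

namespace Equiv.Perm

/-! ### Signs of permutations -/

/-- The sign of a permutation in terms of a set meeting each cycle (fixed points included) in
exactly one element. -/
theorem sign_eq_of_transversal {β : Type*} [Fintype β] [DecidableEq β] (p : Equiv.Perm β)
    (T : Finset β) (hex : ∀ x, ∃ t ∈ T, p.SameCycle x t)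
    (huniq : ∀ t ∈ T, ∀ t' ∈ T, p.SameCycle t t' → t = t') :
    sign p = (-1) ^ (Fintype.card β + T.card) := by
  have hfix : T.filter (fun x => ¬ p x ≠ x) = p.supportᶜ := by
    ext x
    simp only [Finset.mem_filter, Finset.mem_compl, mem_support, and_iff_right_iff_imp, not_not]
    intro hx
    obtain ⟨t, ht, h⟩ := hex x
    obtain ⟨i, rfl⟩ := h
    rwa [zpow_apply_eq_self_of_apply_eq_self hx] at ht
  have hmov : (T.filter (fun x => p x ≠ x)).card = p.cycleFactorsFinset.card := by
    refine Finset.card_bij (fun x _ => p.cycleOf x) ?_ ?_ ?_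
    · intro x hx
      exact cycleOf_mem_cycleFactorsFinset_iff.2 (mem_support.2 (Finset.mem_filter.1 hx).2)
    · intro x hx y hy h
      rw [Finset.mem_filter] at hx hy
      exact huniq x hx.1 y hy.1 ((sameCycle_iff_cycleOf_eq_of_mem_support
        (mem_support.2 hx.2) (mem_support.2 hy.2)).2 h)
    · intro c hc
      obtain ⟨x, hx⟩ := (mem_cycleFactorsFinset_iff.1 hc).1.nonempty_support
      obtain ⟨t, ht, h⟩ := hex x
      have hxp : p x ≠ x := mem_support.1 (mem_cycleFactorsFinset_support_le hc hx)
      refine ⟨t, Finset.mem_filter.2 ⟨ht, ?_⟩, ?_⟩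
      · intro h'
        exact hxp (h.apply_eq_self_iff.2 h')
      · rw [← h.cycleOf_eq]
        exact (cycle_is_cycleOf hx hc).symm
  have hcard := Finset.card_filter_add_card_filter_not (s := T) (fun x => p x ≠ x)
  have hc := Finset.card_add_card_compl p.support
  have hct : Multiset.card p.cycleType = p.cycleFactorsFinset.card := by
    simp [cycleType_def]
  rw [hfix, hmov] at hcard
  rw [sign_of_cycleType, sum_cycleType, hct, ← hcard, ← hc]
  -- Cycle types omit fixed points, while both the ground set and the transversal count each of
  -- them; the two contributions cancel mod 2.
  have : p.support.card + p.supportᶜ.card + (p.cycleFactorsFinset.card + p.supportᶜ.card) =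
    (p.support.card + p.cycleFactorsFinset.card) + 2 * p.supportᶜ.card := by ring
  rw [this, pow_add _ (p.support.card + _), pow_mul (-1 : ℤˣ) 2, neg_one_sq, one_pow, mul_one]

/-- The sign of a permutation in terms of a function whose product over each cycle (fixed points
included) is `-1`. -/
theorem sign_eq_of_prod_sameCycle {β : Type*} [Fintype β] [DecidableEq β] (p : Equiv.Perm β)
    [DecidableRel p.SameCycle] (u : β → ℤˣ) (hu : ∀ x, ∏ y with p.SameCycle x y, u y = -1) :
    sign p = (-1) ^ Fintype.card β * ∏ y, u y := by
  classical
  let r : β → β := fun x => (Quotient.mk (SameCycle.setoid p) x).out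
  have hr : ∀ x, p.SameCycle (r x) x := fun x =>
    Quotient.exact (Quotient.out_eq (Quotient.mk (SameCycle.setoid p) x))
  have hrr : ∀ x y, p.SameCycle x y → r x = r y := fun x y h => by
    simp only [r]
    rw [Quotient.sound (s := SameCycle.setoid p) h]
  let T := Finset.univ.image r
  have hT : ∀ t ∈ T, r t = t := by
    intro t ht
    obtain ⟨x, -, rfl⟩ := Finset.mem_image.1 ht
    exact hrr _ _ (hr x)
  rw [sign_eq_of_transversal p T (fun x => ⟨r x, Finset.mem_image_of_mem r (Finset.mem_univ x),
    (hr x).symm⟩) (fun t ht t' ht' h => by rw [← hT t ht, ← hT t' ht', hrr _ _ h]), pow_add]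
  congr 1
  rw [← Finset.prod_fiberwise_of_maps_to (t := T) (g := r)
    (fun x _ => Finset.mem_image_of_mem r (Finset.mem_univ x)), ← Finset.prod_const]
  refine Finset.prod_congr rfl fun t ht => ?_
  rw [← hu t]
  refine Finset.prod_congr (Finset.filter_congr fun x _ => ⟨fun h => ?_, fun h => ?_⟩) fun _ _ => rfl
  · rw [← hrr _ _ h, hT t ht]
  · rw [← h]; exact hr x

/-- If a permutation `p` interchanges the two classes of a colouring, its sign is that of its square
on one class, up to the parity of the class. The square on the class is given as `g`. -/
theorem sign_eq_of_interchange {β γ : Type*} [Fintype β] [DecidableEq β] [Fintype γ]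
    [DecidableEq γ] (p : Equiv.Perm β) (col : β → Bool) (hcol : ∀ x, col (p x) = !col x)
    (g : Equiv.Perm γ) (i : β → γ)
    (hg : ∀ x, col x = false → p (p x) ≠ x → i (p (p x)) = g (i x))
    (hi : ∀ x y, col x = false → col y = false → p (p x) ≠ x → p (p y) ≠ y → i x = i y → x = y)
    (hsurj : ∀ y, g y ≠ y → ∃ x, col x = false ∧ p (p x) ≠ x ∧ i x = y) :
    sign p = (-1) ^ (Finset.univ.filter fun x => col x = false).card * sign g := by
  have hcol' : ∀ x, col (p.symm x) = !col x := fun x => by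
    have := hcol (p.symm x)
    rw [Equiv.apply_symm_apply] at this
    simp [this]
  -- `q` pairs each `x` of the class `true` with `p x`. It undoes `p` on that class, so `q * p` is
  -- the identity there and `p²` on the class `false`.
  let q0 : β → β := fun x => if col x = true then p x else p.symm x
  have hq0 : Function.Involutive q0 := by
    intro x
    cases h : col x <;> simp [q0, h, hcol, hcol']
  let q : Equiv.Perm β := hq0.toPerm
  have hq : ∀ x, q x = if col x = true then p x else p.symm x := fun x => rfl
  have hqcol : ∀ x, col (q x) = !col x := by
    intro x
    cases h : col x <;> simp [hq, h, hcol, hcol']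
  have hqq : ∀ x, q (q x) = x := hq0
  have hqp : ∀ x, (q * p) x = if col x = true then x else p (p x) := by
    intro x
    cases h : col x <;> simp [hq, h, hcol]
  have hqsign : sign q = (-1) ^ (Finset.univ.filter fun x => col x = false).card := by
    have hcard : (Finset.univ.filter fun x => col x = true).card =
        (Finset.univ.filter fun x => col x = false).card :=
      Finset.card_bij (fun x _ => q x) (by simp +contextual [hqcol]) (by simp)
        (fun y hy => ⟨q y, by simp_all⟩)
    have htot := Finset.card_filter_add_card_filter_not (s := (Finset.univ : Finset β))
      (fun x => col x = true)
    simp only [Bool.not_eq_true, Finset.card_univ] at htot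
    rw [sign_eq_of_transversal q (Finset.univ.filter fun x => col x = true)]
    · rw [← htot, hcard, pow_add, pow_add, ← mul_pow]
      simp
    · intro x
      cases h : col x
      · exact ⟨q x, by simp [hqcol, h], ⟨1, by simp⟩⟩
      · exact ⟨x, by simp [h], SameCycle.refl _ _⟩
    · intro t ht t' ht' h
      simp only [Finset.mem_filter, Finset.mem_univ, true_and] at ht ht'
      obtain ⟨k, hk⟩ := h
      have hq2 : q ^ (2 : ℤ) = 1 := by
        rw [zpow_two]
        exact ext hqq
      rcases Int.even_or_odd' k with ⟨l, rfl | rfl⟩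
      · rw [zpow_mul, hq2, one_zpow] at hk
        exact hk
      · rw [zpow_add, zpow_mul, hq2, one_zpow, one_mul, zpow_one] at hk
        have := hqcol t
        simp_all
  have hmul : sign (q * p) = sign g := by
    refine sign_bij (fun x _ => i x) ?_ ?_ ?_
    · intro x hx _
      rw [hqp] at hx ⊢
      cases h : col x
      · simp only [h, Bool.false_eq_true, if_false] at hx ⊢
        exact hg x h hx
      · simp [h] at hx
    · intro x y hx hy h
      rw [hqp] at hx hy
      cases h1 : col x
      · cases h2 : col y
        · simp only [h1, h2, Bool.false_eq_true, if_false] at hx hy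
          exact hi x y h1 h2 hx hy h
        · simp [h2] at hy
      · simp [h1] at hx
    · intro y hy
      obtain ⟨x, h1, h2, h3⟩ := hsurj y hy
      exact ⟨x, by simpa [hqp, h1] using h2, h3⟩
  rw [← hmul, sign_mul, ← hqsign, ← mul_assoc, Int.units_mul_self, one_mul]

/-- A finite set that is invariant under a permutation interchanging the two classes of a colouring
has equally many elements in both. -/
theorem card_eq_two_mul_card_filter {α : Type*} [DecidableEq α] (p : Equiv.Perm α) (col : α → Bool)
    (hcol : ∀ x, col (p x) = !col x) (S : Finset α) (hS : ∀ x, p x ∈ S ↔ x ∈ S) :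
    S.card = 2 * (S.filter fun x => col x = false).card := by
  have h : (S.filter fun x => col x = false).card = (S.filter fun x => ¬ col x = false).card := by
    refine Finset.card_bij (fun x _ => p x) (by simp +contextual [hS, hcol]) (by simp) ?_
    intro y hy
    have := hS (p.symm y)
    have := hcol (p.symm y)
    exact ⟨p.symm y, by simp_all, by simp⟩
  rw [← Finset.card_filter_add_card_filter_not (s := S) fun x => col x = false]
  omega

/-- Inverting a permutation on an invariant set does not change its sign. -/
theorem exists_perm_inverting {α : Type*} [Fintype α] [DecidableEq α] (τ : Equiv.Perm α)
    (S : α → Prop) [DecidablePred S] (hS : ∀ i, S (τ i) ↔ S i) :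
    ∃ g : Equiv.Perm α, (∀ i, S i → g i = τ i) ∧ (∀ i, ¬ S i → g i = τ.symm i) ∧
      Equiv.Perm.sign g = Equiv.Perm.sign τ := by
  have hS' : ∀ i, ¬ S (τ.symm i) ↔ ¬ S i := fun i => by
    rw [← hS (τ.symm i), Equiv.apply_symm_apply]
  -- `w` is `τ⁻¹` off `S` and the identity on `S`. Multiplying `τ` by the even permutation `w²`
  -- therefore inverts it exactly off `S`.
  let w := Equiv.Perm.ofSubtype (Equiv.Perm.subtypePerm (p := fun i => ¬ S i) τ.symm hS')
  have hw : ∀ i, ¬ S i → w i = τ.symm i := fun i hi =>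
    Equiv.Perm.ofSubtype_apply_of_mem (p := fun i => ¬ S i) _ hi
  refine ⟨τ * (w * w), fun i hi => ?_, fun i hi => ?_, ?_⟩
  · have : w i = i := Equiv.Perm.ofSubtype_apply_of_not_mem
      (p := fun i => ¬ S i) _ (not_not.2 hi)
    rw [Equiv.Perm.mul_apply, Equiv.Perm.mul_apply, this, this]
  · rw [Equiv.Perm.mul_apply, Equiv.Perm.mul_apply, hw i hi, hw _ ((hS' i).2 hi),
      Equiv.apply_symm_apply]
  · rw [Equiv.Perm.sign_mul, Equiv.Perm.sign_mul, Int.units_mul_self, mul_one]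

end Equiv.Perm

/-! ### Homology mod 2 of the sphere -/

namespace BipartiteGraph

variable {n : ℕ} {E : Type*}

@[simp] theorem reversal_apply (d : Dart E) : reversal E d = (d.1, !d.2) := rfl

theorem sum_dart [Fintype E] {M : Type*} [AddCommMonoid M] (g : Dart E → M) :
    ∑ d, g d = ∑ e, (g (e, false) + g (e, true)) := by
  rw [Fintype.sum_prod_type]
  exact Finset.sum_congr rfl fun e _ => by rw [Fintype.sum_bool, add_comm]

/-- The coboundary over the field with two elements, from functions on the cycles of `p` to
functions on the edges. -/
def coboundary (p : Equiv.Perm (Dart E)) : (Cycles p → ZMod 2) →ₗ[ZMod 2] (E → ZMod 2) :=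
  LinearMap.funLeft (ZMod 2) (ZMod 2) (fun e => (Quotient.mk _ (e, false) : Cycles p)) +
    LinearMap.funLeft (ZMod 2) (ZMod 2) (fun e => (Quotient.mk _ (e, true) : Cycles p))

theorem coboundary_apply (p : Equiv.Perm (Dart E)) (g : Cycles p → ZMod 2) (e : E) :
    coboundary p g e = g (Quotient.mk _ (e, false)) + g (Quotient.mk _ (e, true)) := rfl

theorem mk_apply_eq (p : Equiv.Perm (Dart E)) (d : Dart E) :
    (Quotient.mk _ (p d) : Cycles p) = Quotient.mk _ d :=
  Quotient.sound (s := Equiv.Perm.SameCycle.setoid p)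
    (Equiv.Perm.sameCycle_apply_left.2 (Equiv.Perm.SameCycle.refl _ _))

theorem mk_reversal_eq_of_mem_ker {p : Equiv.Perm (Dart E)} {g : Cycles p → ZMod 2}
    (hg : g ∈ LinearMap.ker (coboundary p)) (d : Dart E) :
    g (Quotient.mk _ (reversal E d)) = g (Quotient.mk _ d) := by
  have h := congrFun (LinearMap.mem_ker.1 hg) d.1
  rw [coboundary_apply, Pi.zero_apply, CharTwo.add_eq_zero] at h
  obtain ⟨e, b⟩ := d
  cases b
  · exact h.symm
  · exact h

/-- The kernel of the coboundary has dimension at most the number of orbits of a group of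
permutations under which all functions in the kernel are invariant. -/
theorem finrank_ker_coboundary_le [Fintype E] (p : Equiv.Perm (Dart E))
    (S : Set (Equiv.Perm (Dart E))) (hp : p ∈ Subgroup.closure S)
    (hS : ∀ a ∈ S, ∀ g ∈ LinearMap.ker (coboundary p), ∀ d,
      g (Quotient.mk _ (a d)) = g (Quotient.mk _ d)) :
    Module.finrank (ZMod 2) (LinearMap.ker (coboundary p)) ≤
      Nat.card (MulAction.orbitRel.Quotient (Subgroup.closure S) (Dart E)) := by
  classical
  let G := Subgroup.closure S
  let φ : Cycles p → MulAction.orbitRel.Quotient G (Dart E) :=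
    Quotient.map' id (by
      rintro a b ⟨k, hk⟩
      have : MulAction.orbitRel G (Dart E) b a :=
        MulAction.orbitRel_apply.2 ⟨⟨p ^ k, G.zpow_mem hp k⟩, hk⟩
      exact (MulAction.orbitRel G (Dart E)).symm this)
  have : Finite (MulAction.orbitRel.Quotient G (Dart E)) := Quotient.finite _
  have := Fintype.ofFinite (MulAction.orbitRel.Quotient G (Dart E))
  -- Functions in the kernel are constant on orbits, hence pulled back along `φ`.
  have hle : LinearMap.ker (coboundary p) ≤
      LinearMap.range (LinearMap.funLeft (ZMod 2) (ZMod 2) φ) := by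
    intro g hg
    have hinv : ∀ a ∈ G, ∀ d, g (Quotient.mk _ (a d)) = g (Quotient.mk _ d) := by
      intro a ha
      induction ha using Subgroup.closure_induction with
      | mem a ha => exact hS a ha g hg
      | one => exact fun d => rfl
      | mul a b _ _ iha ihb => exact fun d => (iha (b d)).trans (ihb d)
      | inv a _ iha =>
        intro d
        have := iha (a⁻¹ d)
        rw [← Equiv.Perm.mul_apply, mul_inv_cancel, Equiv.Perm.one_apply] at this
        exact this.symm
    refine ⟨Quotient.lift (fun d => g (Quotient.mk _ d)) ?_, ?_⟩
    · rintro a b ⟨⟨c, hc⟩, h⟩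
      rw [← h]
      exact hinv c hc b
    · ext c
      induction c using Quotient.ind
      rfl
  calc _ ≤ _ := Submodule.finrank_mono hle
    _ ≤ _ := LinearMap.finrank_range_le _
    _ = _ := by rw [Module.finrank_fintype_fun_eq_card, Nat.card_eq_fintype_card]

namespace PlanarEmbedding

variable {Z : BipartiteGraph n E} (P : Z.PlanarEmbedding)

theorem facePerm_apply (d : Dart E) : P.facePerm d = P.next (reversal E d) := rfl

theorem facePerm_reversal (d : Dart E) : P.facePerm (reversal E d) = P.next d := by
  simp [facePerm_apply]

/-- On a sphere each cycle modulo two is the boundary of a set of faces. -/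
theorem exists_face_function [Fintype E] (x : E → ZMod 2)
    (hx : ∀ g : Dart E → ZMod 2, (∀ d, g (P.next d) = g d) → ∑ d, x d.1 * g d = 0) :
    ∃ h : Dart E → ZMod 2, (∀ d, h (P.facePerm d) = h d) ∧
      ∀ e, h (e, false) + h (e, true) = x e := by
  classical
  let B : LinearMap.BilinForm (ZMod 2) (E → ZMod 2) := dotProductBilin (ZMod 2) (ZMod 2)
  have hBapp : ∀ v w, B v w = ∑ e, v e * w e := fun v w => rfl
  have hB : B.Nondegenerate := by
    refine ⟨fun v hv => dotProduct_eq_zero v hv, fun v hv => dotProduct_eq_zero v fun w => ?_⟩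
    rw [dotProduct_comm]
    exact hv w
  let C := Subgroup.closure ({P.next, reversal E} : Set (Equiv.Perm (Dart E)))
  have hnext : P.next ∈ C := Subgroup.subset_closure (by simp)
  have hrev : reversal E ∈ C := Subgroup.subset_closure (by simp)
  have := Fintype.ofFinite (Cycles P.next)
  have := Fintype.ofFinite (Cycles P.facePerm)
  have h1 := finrank_ker_coboundary_le P.next {P.next, reversal E} hnext (by
    rintro a (rfl | rfl) g hg d
    · rw [mk_apply_eq]
    · exact mk_reversal_eq_of_mem_ker hg d)
  have h2 := finrank_ker_coboundary_le P.facePerm {P.next, reversal E} (C.mul_mem hnext hrev) (by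
    rintro a (rfl | rfl) g hg d
    · rw [← facePerm_reversal, mk_apply_eq]
      exact mk_reversal_eq_of_mem_ker hg d
    · exact mk_reversal_eq_of_mem_ker hg d)
  have r1 := LinearMap.finrank_range_add_finrank_ker (coboundary P.next)
  have r2 := LinearMap.finrank_range_add_finrank_ker (coboundary P.facePerm)
  rw [Module.finrank_fintype_fun_eq_card, ← Nat.card_eq_fintype_card] at r1 r2
  have heuler : (Nat.card (Cycles P.next) : ℤ) - Nat.card E + Nat.card (Cycles P.facePerm) = _ :=
    P.euler
  have hmem : ∀ {y}, (∀ g : Dart E → ZMod 2, (∀ d, g (P.next d) = g d) → ∑ d, y d.1 * g d = 0) →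
      y ∈ B.orthogonal (LinearMap.range (coboundary P.next)) := by
    rintro y hy _ ⟨g, rfl⟩
    rw [hBapp, ← hy (fun d => g (Quotient.mk _ d)) (fun d => by rw [mk_apply_eq]), sum_dart]
    exact Finset.sum_congr rfl fun e _ => by rw [coboundary_apply]; ring
  have hle : LinearMap.range (coboundary P.facePerm) ≤
      B.orthogonal (LinearMap.range (coboundary P.next)) := by
    rintro _ ⟨h, rfl⟩
    refine hmem fun g hg => ?_
    let h' : Dart E → ZMod 2 := fun d => h (Quotient.mk _ d)
    -- Boundaries are cycles: `P.next d` belongs to the same face as the reversal of `d`, and since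
    -- `g` is constant around vertices the two resulting sums agree and cancel mod 2.
    have e1 : ∀ d : Dart E, coboundary P.facePerm h d.1 = h' d + h' (P.next d) := by
      intro d
      rw [← facePerm_reversal]
      simp only [h', mk_apply_eq, coboundary_apply]
      obtain ⟨e, b⟩ := d
      cases b
      · rfl
      · exact add_comm _ _
    have e2 : ∑ d, h' (P.next d) * g d = ∑ d, h' d * g d := by
      rw [← Equiv.sum_comp P.next fun d => h' d * g d]
      exact Finset.sum_congr rfl fun d _ => by rw [hg]
    simp only [e1, add_mul, Finset.sum_add_distrib, e2]
    exact CharTwo.add_self_eq_zero _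
  -- With `V`, `E`, `F`, `c` the numbers of vertices, edges, faces and components, the boundaries
  -- have dimension at least `F - c` and the cycles at most `E - V + c`. Euler's formula makes these
  -- bounds equal.
  have hdim := LinearMap.BilinForm.finrank_orthogonal hB (LinearMap.range (coboundary P.next))
  rw [Module.finrank_fintype_fun_eq_card, ← Nat.card_eq_fintype_card] at hdim
  have heq := Submodule.eq_of_le_of_finrank_le hle (by omega)
  obtain ⟨h, hh⟩ : x ∈ LinearMap.range (coboundary P.facePerm) := heq ▸ hmem hx
  exact ⟨fun d => h (Quotient.mk _ d), fun d => congrArg h (mk_apply_eq _ d),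
    fun e => congrFun hh e⟩

end PlanarEmbedding

/-! ### Matching darts and their exchange -/

variable {Z : BipartiteGraph n E}

/-- `μ v` is the dart of the matching `m` that departs from the vertex `v`. -/
structure IsMatchingDart (Z : BipartiteGraph n E) (m : Finset E) (μ : Fin n ⊕ Fin n → Dart E) :
    Prop where
  origin_eq : ∀ v, Z.origin (μ v) = v
  mem_iff : ∀ d, d.1 ∈ m ↔ d = μ (Z.origin d)

theorem IsPerfectMatching.exists_isMatchingDart {m : Finset E} (hm : Z.IsPerfectMatching m) :
    ∃ μ, Z.IsMatchingDart m μ := by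
  choose b hb hb' using hm.1
  choose w hw hw' using hm.2
  refine ⟨Sum.elim (fun i => (b i, false)) fun j => (w j, true), ?_, ?_⟩
  · rintro (i | j)
    · simp [origin, hb]
    · simp [origin, hw]
  · rintro ⟨e, _ | _⟩
    · simp only [origin, Bool.false_eq_true, if_false, Sum.elim_inl, Prod.mk.injEq, and_true]
      exact ⟨fun h => hb' _ e ⟨h, rfl⟩, fun h => h ▸ (hb _).1⟩
    · simp only [origin, if_true, Sum.elim_inr, Prod.mk.injEq, and_true]
      exact ⟨fun h => hw' _ e ⟨h, rfl⟩, fun h => h ▸ (hw _).1⟩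

namespace IsMatchingDart

variable {m : Finset E} {μ : Fin n ⊕ Fin n → Dart E}

theorem mem (hμ : Z.IsMatchingDart m μ) (v : Fin n ⊕ Fin n) : (μ v).1 ∈ m := by
  rw [hμ.mem_iff, hμ.origin_eq]

theorem inl_snd (hμ : Z.IsMatchingDart m μ) (i : Fin n) : (μ (Sum.inl i)).2 = false := by
  have h := hμ.origin_eq (Sum.inl i)
  cases h' : (μ (Sum.inl i)).2
  · rfl
  · simp [origin, h'] at h

theorem black_inl (hμ : Z.IsMatchingDart m μ) (i : Fin n) : Z.black (μ (Sum.inl i)).1 = i := by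
  have h := hμ.origin_eq (Sum.inl i)
  simpa [origin, hμ.inl_snd] using h

theorem reversal_inl (hμ : Z.IsMatchingDart m μ)
    {σ : Equiv.Perm (Fin n)} (hσ : ∀ e ∈ m, Z.white e = σ (Z.black e)) (i : Fin n) : reversal E (μ (Sum.inl i)) = μ (Sum.inr (σ i)) := by
  have h := (hμ.mem_iff (reversal E (μ (Sum.inl i)))).1 (hμ.mem _)
  rw [h]
  simp [origin, hμ.inl_snd, hσ _ (hμ.mem _), hμ.black_inl]

theorem reversal_inr (hμ : Z.IsMatchingDart m μ)
    {σ : Equiv.Perm (Fin n)} (hσ : ∀ e ∈ m, Z.white e = σ (Z.black e)) (j : Fin n) : reversal E (μ (Sum.inr j)) = μ (Sum.inl (σ.symm j)) := by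
  have h := hμ.reversal_inl hσ (σ.symm j)
  rw [Equiv.apply_symm_apply] at h
  rw [← h]
  simp

theorem sum_eq [Fintype E] [DecidableEq E] (hμ : Z.IsMatchingDart m μ) (g : Dart E → ZMod 2) :
    ∑ d : Dart E, (if d.1 ∈ m then 1 else 0) * g d = ∑ v, g (μ v) := by
  simp only [ite_mul, one_mul, zero_mul]
  rw [← Finset.sum_filter]
  refine (Finset.sum_bij (fun v _ => μ v) (by simp [hμ.mem]) ?_ ?_ (fun _ _ => rfl)).symm
  · intro v _ w _ h
    rw [← hμ.origin_eq v, h, hμ.origin_eq]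
  · intro d hd
    exact ⟨Z.origin d, Finset.mem_univ _, ((hμ.mem_iff d).1 (by simpa using hd)).symm⟩

end IsMatchingDart

open Classical in
/-- The involution of the darts that interchanges `μ v` and `μ' v` for each vertex `v`. -/
noncomputable def exchange {μ μ' : Fin n ⊕ Fin n → Dart E} (h : ∀ v, Z.origin (μ v) = v)
    (h' : ∀ v, Z.origin (μ' v) = v) : Equiv.Perm (Dart E) :=
  Function.Involutive.toPerm
    (fun d => Equiv.swap (μ (Z.origin d)) (μ' (Z.origin d)) d) fun d => by
      have ho : Z.origin (Equiv.swap (μ (Z.origin d)) (μ' (Z.origin d)) d) = Z.origin d := by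
        rw [Equiv.swap_apply_def]
        split_ifs <;> simp [h, h']
      simp only [ho, Equiv.swap_apply_self]

section exchange

variable {μ μ' : Fin n ⊕ Fin n → Dart E} (h : ∀ v, Z.origin (μ v) = v)
    (h' : ∀ v, Z.origin (μ' v) = v)

open Classical in
theorem exchange_apply (d) :
    exchange h h' d = Equiv.swap (μ (Z.origin d)) (μ' (Z.origin d)) d := rfl

theorem exchange_left (v) : exchange h h' (μ v) = μ' v := by
  simp [exchange_apply, h]

theorem exchange_right (v) : exchange h h' (μ' v) = μ v := by
  simp [exchange_apply, h']

theorem exchange_of_ne {d : Dart E} (hd : d ≠ μ (Z.origin d)) (hd' : d ≠ μ' (Z.origin d)) :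
    exchange h h' d = d := by
  classical
  rw [exchange_apply, Equiv.swap_apply_of_ne_of_ne hd hd']

theorem exchange_exchange (d) : exchange h h' (exchange h h' d) = d :=
  Function.Involutive.toPerm_involutive _ d

theorem origin_exchange (d) : Z.origin (exchange h h' d) = Z.origin d := by
  classical
  by_cases hd : d = μ (Z.origin d)
  · rw [hd, exchange_left]; simp [h, h']
  · by_cases hd' : d = μ' (Z.origin d)
    · rw [hd', exchange_right]; simp [h, h']
    · rw [exchange_of_ne h h' hd hd']

end exchange

/-! ### Colours and flatness around a face -/

theorem snd_eq_of_origin_eq {d d' : Dart E} (h : Z.origin d = Z.origin d') : d.2 = d'.2 := by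
  cases h1 : d.2 <;> cases h2 : d'.2 <;> simp [origin, h1, h2] at h ⊢

theorem PlanarEmbedding.origin_next (P : Z.PlanarEmbedding) (d : Dart E) :
    Z.origin (P.next d) = Z.origin d :=
  (P.sameCycle_next_iff _ _).1 (Equiv.Perm.sameCycle_apply_left.2 (Equiv.Perm.SameCycle.refl _ _))

/-- A boundary walk alternates in colour because every edge joins opposite colours. Hence every face
has an even number of sides, and one of the two clauses of flatness always applies. -/
theorem PlanarEmbedding.facePerm_snd (P : Z.PlanarEmbedding) (d : Dart E) :
    (P.facePerm d).2 = !d.2 := by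
  rw [P.facePerm_apply, snd_eq_of_origin_eq (P.origin_next _)]
  rfl

/-- In a flat signing the product over a face of the signs of its sides is the opposite of
`(-1) ^ k`, where `k` is the number of sides directed from black to white. -/
theorem PlanarEmbedding.IsFlat.prod_face [Fintype E] [DecidableEq E] {P : Z.PlanarEmbedding}
    {s : E → ℤˣ} (hs : P.IsFlat s) [DecidableRel P.facePerm.SameCycle] (x : Dart E) :
    ∏ y with P.facePerm.SameCycle x y, (s y.1 * if y.2 = false then -1 else 1) = -1 := by
  set S := Finset.univ.filter fun y => P.facePerm.SameCycle x y with hSdef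
  have hsides : P.sides (Quotient.mk _ x) = (S : Set (Dart E)) := by
    ext y
    simp only [PlanarEmbedding.sides, Set.mem_ofPred_eq, hSdef, Finset.coe_filter,
      Finset.mem_univ, true_and]
    exact Quotient.eq.trans ⟨fun h => h.symm, fun h => h.symm⟩
  have hneg : P.negativeSides s (Quotient.mk _ x) =
      ((S.filter fun y => s y.1 = -1 : Finset (Dart E)) : Set (Dart E)) := by
    rw [PlanarEmbedding.negativeSides, hsides]
    ext y
    simp
  have hF := hs (Quotient.mk _ x)
  rw [hsides, hneg, Set.ncard_coe_finset, Set.ncard_coe_finset] at hF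
  have hcard := Equiv.Perm.card_eq_two_mul_card_filter P.facePerm Prod.snd P.facePerm_snd S (by
    intro y; simp [hSdef])
  have h1 : ∏ y ∈ S, s y.1 = (-1) ^ (S.filter fun y => s y.1 = -1).card := by
    rw [← Finset.prod_const, Finset.prod_filter (fun y : Dart E => s y.1 = -1)]
    refine Finset.prod_congr rfl fun y _ => ?_
    rcases Int.units_eq_one_or (s y.1) with h | h <;> simp [h]
  rw [Finset.prod_mul_distrib, h1, ← Finset.prod_filter, Finset.prod_const]
  -- A face with `k` black-to-white sides has `2k` sides in all, so the parity of `k` selects the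
  -- clause.
  rcases Nat.even_or_odd' (S.filter fun x => x.2 = false).card with ⟨k, hk | hk⟩
  · rw [(hF.1 ⟨k, by omega⟩).neg_one_pow, hk, pow_mul]
    simp
  · rw [(hF.2 ⟨k, by omega⟩).neg_one_pow, hk, pow_succ, pow_mul]
    simp

/-! ### The region between two matchings -/

open Classical in
/-- The indicator of the symmetric difference of two sets of edges. -/
noncomputable def indicatorDiff (m m' : Finset E) (e : E) : ZMod 2 :=
  (if e ∈ m then 1 else 0) + if e ∈ m' then 1 else 0

/-- `h` is the indicator of a set of faces whose boundary is the symmetric difference of the sets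
`m` and `m'` of edges. -/
structure IsBoundedRegion (P : Z.PlanarEmbedding) (m m' : Finset E) (h : Dart E → ZMod 2) :
    Prop where
  face : ∀ d, h (P.facePerm d) = h d
  edge : ∀ d, h (reversal E d) = h d + indicatorDiff m m' d.1

theorem PlanarEmbedding.exists_isBoundedRegion [Fintype E] (P : Z.PlanarEmbedding)
    {m m' : Finset E} (hm : Z.IsPerfectMatching m) (hm' : Z.IsPerfectMatching m') :
    ∃ h, IsBoundedRegion P m m' h := by
  classical
  obtain ⟨μ, hμ⟩ := hm.exists_isMatchingDart
  obtain ⟨μ', hμ'⟩ := hm'.exists_isMatchingDart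
  obtain ⟨h, h1, h2⟩ := P.exists_face_function (indicatorDiff m m') (by
    intro g hg
    -- A function constant around vertices has the same total over `m`-darts as over `m'`-darts:
    -- each matching has one dart at every vertex.
    have e : ∀ v, g (μ v) = g (μ' v) := by
      intro v
      have hv : P.next.SameCycle (μ v) (μ' v) :=
        (P.sameCycle_next_iff _ _).2 (by rw [hμ.origin_eq, hμ'.origin_eq])
      obtain ⟨k, hk⟩ := hv.exists_nat_pow_eq
      rw [← hk]
      clear hk
      induction k with
      | zero => rfl
      | succ k ih => rw [pow_succ', Equiv.Perm.mul_apply, hg, ← ih]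
    simp only [indicatorDiff, add_mul, Finset.sum_add_distrib]
    convert CharTwo.add_self_eq_zero (∑ v, g (μ v)) using 2
    · convert hμ.sum_eq g
    · simp only [e]
      convert hμ'.sum_eq g)
  refine ⟨h, h1, ?_⟩
  rintro ⟨e, b⟩
  rw [← h2 e]
  cases b
  · simp [← add_assoc, CharTwo.add_self_eq_zero]
  · rw [add_comm (h (e, false)), ← add_assoc, CharTwo.add_self_eq_zero, zero_add]
    rfl

namespace IsBoundedRegion

variable {P : Z.PlanarEmbedding} {m m' : Finset E} {h : Dart E → ZMod 2}
  {μ μ' : Fin n ⊕ Fin n → Dart E}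

theorem next (hh : IsBoundedRegion P m m' h) (d : Dart E) :
    h (P.next d) = h d + indicatorDiff m m' d.1 := by
  rw [← P.facePerm_reversal, hh.face, hh.edge]

/-- Rotating about `v`, `h` changes on leaving `μ v` and can change again only on leaving `μ' v`. If
both darts had the same value, the changed value would persist and the rotation could never come
back to `μ v`. So where the matchings differ, exactly one of the two darts lies in the region. -/
theorem apply_ne [Finite E] (hh : IsBoundedRegion P m m' h) (hμ : Z.IsMatchingDart m μ)
    (hμ' : Z.IsMatchingDart m' μ') {v : Fin n ⊕ Fin n} (hv : μ v ≠ μ' v) : h (μ v) ≠ h (μ' v) := by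
  intro heq
  have hx : indicatorDiff m m' (μ v).1 = 1 := by
    have : (μ v).1 ∉ m' := by rwa [hμ'.mem_iff, hμ.origin_eq]
    simp [indicatorDiff, hμ.mem, this]
  have hne : h (P.next (μ v)) ≠ h (μ v) := by
    rw [hh.next, hx]
    simp
  have key : ∀ k : ℕ, h ((P.next ^ k) (P.next (μ v))) = h (P.next (μ v)) ∧
      Z.origin ((P.next ^ k) (P.next (μ v))) = v := by
    intro k
    induction k with
    | zero => exact ⟨rfl, by rw [pow_zero, Equiv.Perm.one_apply, P.origin_next, hμ.origin_eq]⟩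
    | succ k ih =>
      obtain ⟨ih1, ih2⟩ := ih
      rw [pow_succ', Equiv.Perm.mul_apply]
      set y := (P.next ^ k) (P.next (μ v))
      refine ⟨?_, by rw [P.origin_next, ih2]⟩
      have h1 : y.1 ∉ m := by
        rw [hμ.mem_iff, ih2]
        intro hy
        rw [hy] at ih1
        exact hne ih1.symm
      have h2 : y.1 ∉ m' := by
        rw [hμ'.mem_iff, ih2]
        intro hy
        rw [hy, ← heq] at ih1
        exact hne ih1.symm
      rw [hh.next, ih1]
      simp [indicatorDiff, h1, h2]
  have hc : P.next.SameCycle (P.next (μ v)) (μ v) :=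
    Equiv.Perm.sameCycle_apply_left.2 (Equiv.Perm.SameCycle.refl _ _)
  obtain ⟨k, hk⟩ := hc.exists_nat_pow_eq
  exact hne (by rw [← (key k).1, hk])

theorem eq_of_origin_eq [Finite E] (hh : IsBoundedRegion P m m' h) (hμ : Z.IsMatchingDart m μ)
    (hμ' : Z.IsMatchingDart m' μ') {d d' : Dart E} (ho : Z.origin d = Z.origin d')
    (hd : d.1 ∈ m ∨ d.1 ∈ m') (hd' : d'.1 ∈ m ∨ d'.1 ∈ m') (heq : h d = h d') : d = d' := by
  rw [hμ.mem_iff, hμ'.mem_iff] at hd hd'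
  rw [← ho] at hd'
  by_contra hne
  rcases hd with hd | hd <;> rcases hd' with hd' | hd'
  · exact hne (hd.trans hd'.symm)
  · have : μ (Z.origin d) ≠ μ' (Z.origin d) := by rwa [← hd, ← hd']
    exact hh.apply_ne hμ hμ' this (by rw [← hd, ← hd', heq])
  · have : μ (Z.origin d) ≠ μ' (Z.origin d) := by rw [← hd, ← hd']; exact Ne.symm hne
    exact hh.apply_ne hμ hμ' this (by rw [← hd, ← hd', heq])
  · exact hne (hd.trans hd'.symm)

/-- The exchange alters `h` by the same amount as `next` and reversal do. Its composites with these
therefore preserve the region. -/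
theorem apply_exchange [Finite E] (hh : IsBoundedRegion P m m' h) (hμ : Z.IsMatchingDart m μ)
    (hμ' : Z.IsMatchingDart m' μ') (d : Dart E) :
    h (exchange hμ.origin_eq hμ'.origin_eq d) = h d + indicatorDiff m m' d.1 := by
  have two : ∀ a b : ZMod 2, a ≠ b → b = a + 1 := by decide
  by_cases h1 : d = μ (Z.origin d)
  · by_cases h2 : d = μ' (Z.origin d)
    · have e : BipartiteGraph.exchange hμ.origin_eq hμ'.origin_eq d = d := by
        conv_lhs => rw [h1]
        rw [exchange_left, ← h2]
      rw [e]
      simp [indicatorDiff, (hμ.mem_iff d).2 h1, (hμ'.mem_iff d).2 h2, CharTwo.add_self_eq_zero]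
    · have h2' : d.1 ∉ m' := by rwa [hμ'.mem_iff]
      have e : BipartiteGraph.exchange hμ.origin_eq hμ'.origin_eq d = μ' (Z.origin d) := by
        conv_lhs => rw [h1]
        rw [exchange_left]
      have := hh.apply_ne hμ hμ' (v := Z.origin d) (by rwa [← h1])
      rw [← h1] at this
      simp [indicatorDiff, (hμ.mem_iff d).2 h1, h2', e, two _ _ this]
  · have h1' : d.1 ∉ m := by rwa [hμ.mem_iff]
    by_cases h2 : d = μ' (Z.origin d)
    · have e : BipartiteGraph.exchange hμ.origin_eq hμ'.origin_eq d = μ (Z.origin d) := by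
        conv_lhs => rw [h2]
        rw [exchange_right]
      have := hh.apply_ne hμ hμ' (v := Z.origin d) (by rw [← h2]; exact Ne.symm h1)
      rw [← h2] at this
      simp [indicatorDiff, (hμ'.mem_iff d).2 h2, h1', e, two _ _ this.symm]
    · have h2' : d.1 ∉ m' := by rwa [hμ'.mem_iff]
      rw [exchange_of_ne _ _ h1 h2]
      simp [indicatorDiff, h1', h2']

theorem mem_exchange (hμ : Z.IsMatchingDart m μ) (hμ' : Z.IsMatchingDart m' μ') (d : Dart E) :
    ((BipartiteGraph.exchange hμ.origin_eq hμ'.origin_eq d).1 ∈ m ∨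
      (BipartiteGraph.exchange hμ.origin_eq hμ'.origin_eq d).1 ∈ m') ↔ (d.1 ∈ m ∨ d.1 ∈ m') := by
  have key : ∀ d : Dart E, (d.1 ∈ m ∨ d.1 ∈ m') →
      ((BipartiteGraph.exchange hμ.origin_eq hμ'.origin_eq d).1 ∈ m ∨
      (BipartiteGraph.exchange hμ.origin_eq hμ'.origin_eq d).1 ∈ m') := by
    intro d hd
    rcases hd with hd | hd
    · rw [(hμ.mem_iff d).1 hd, exchange_left]
      exact Or.inr (hμ'.mem _)
    · rw [(hμ'.mem_iff d).1 hd, exchange_right]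
      exact Or.inl (hμ.mem _)
  refine ⟨fun hd => ?_, key d⟩
  have := key _ hd
  rwa [exchange_exchange] at this

theorem apply_next_exchange [Finite E] (hh : IsBoundedRegion P m m' h) (hμ : Z.IsMatchingDart m μ)
    (hμ' : Z.IsMatchingDart m' μ') (d : Dart E) :
    h ((P.next * exchange hμ.origin_eq hμ'.origin_eq) d) = h d := by
  have h1 := hh.apply_exchange hμ hμ' (exchange hμ.origin_eq hμ'.origin_eq d)
  rw [exchange_exchange] at h1
  rw [Equiv.Perm.mul_apply, hh.next, ← h1]

theorem apply_exchange_reversal [Finite E] (hh : IsBoundedRegion P m m' h)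
    (hμ : Z.IsMatchingDart m μ) (hμ' : Z.IsMatchingDart m' μ') (d : Dart E) :
    h ((exchange hμ.origin_eq hμ'.origin_eq * reversal E) d) = h d := by
  rw [Equiv.Perm.mul_apply, hh.apply_exchange hμ hμ', hh.edge, add_assoc]
  rw [show (reversal E d).1 = d.1 from rfl, CharTwo.add_self_eq_zero, add_zero]

theorem exchange_reversal_snd (hμ : Z.IsMatchingDart m μ) (hμ' : Z.IsMatchingDart m' μ')
    (d : Dart E) : ((exchange hμ.origin_eq hμ'.origin_eq * reversal E) d).2 = !d.2 := by
  rw [Equiv.Perm.mul_apply, snd_eq_of_origin_eq (origin_exchange hμ.origin_eq hμ'.origin_eq _)]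
  rfl

/-! ### Signs of the two factors on the region -/

/-- Cutting the vertices along the boundary of the region leaves an even permutation of the darts of
the region. -/
theorem sign_next_exchange [Fintype E] [DecidableEq E] (hh : IsBoundedRegion P m m' h)
    (hμ : Z.IsMatchingDart m μ) (hμ' : Z.IsMatchingDart m' μ') :
    Equiv.Perm.sign ((P.next * exchange hμ.origin_eq hμ'.origin_eq).subtypePerm
      (p := fun d => h d = 1) fun d => by rw [hh.apply_next_exchange hμ hμ']) = 1 := by
  set π := (P.next * exchange hμ.origin_eq hμ'.origin_eq).subtypePerm
      (p := fun d => h d = 1) fun d => by rw [hh.apply_next_exchange hμ hμ']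
  let c := (exchange hμ.origin_eq hμ'.origin_eq * reversal E).subtypePerm
      (p := fun d => h d = 1) fun d => by rw [hh.apply_exchange_reversal hμ hμ']
  have hc : ∀ x, (c x).1.2 = !x.1.2 := fun x => exchange_reversal_snd hμ hμ' x.1
  let T : Finset {d // h d = 1} := Finset.univ.filter fun d => d.1.1 ∈ m ∨ d.1.1 ∈ m'
  have hT : ∀ x, x ∈ T ↔ x.1.1 ∈ m ∨ x.1.1 ∈ m' := fun x => by simp [T]
  have hπo : ∀ (k : ℕ) x, Z.origin ((π ^ k) x).1 = Z.origin x.1 := by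
    intro k x
    induction k with
    | zero => rfl
    | succ k ih =>
      rw [pow_succ', Equiv.Perm.mul_apply]
      exact (P.origin_next _).trans ((origin_exchange _ _ _).trans ih)
  -- The colour-switching `c` preserves both `T` and the whole region, so both have even size. It
  -- remains to see that `T` meets each cycle of `π` once.
  have hcardT := Equiv.Perm.card_eq_two_mul_card_filter c (fun x => x.1.2) hc T (fun x => by
    rw [hT, hT]
    exact mem_exchange hμ hμ' (reversal E x.1))
  have hcard := Equiv.Perm.card_eq_two_mul_card_filter c (fun x => x.1.2) hc Finset.univ (by simp)
  rw [Equiv.Perm.sign_eq_of_transversal π T, ← Finset.card_univ, hcardT, hcard, ← mul_add, pow_mul]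
  · simp
  · intro x
    by_contra! hx
    -- A cycle of `π` avoiding `T` would coincide with a rotation about a vertex, which does reach a
    -- matching dart.
    have key : ∀ k : ℕ, ((π ^ k) x).1 = (P.next ^ k) x.1 := by
      intro k
      induction k with
      | zero => rfl
      | succ k ih =>
        rw [pow_succ', pow_succ', Equiv.Perm.mul_apply, Equiv.Perm.mul_apply, ← ih]
        have hk : (π ^ k) x ∉ T := fun hk => hx _ hk ⟨k, by simp⟩
        rw [hT, hμ.mem_iff, hμ'.mem_iff] at hk
        push Not at hk
        change P.next (exchange _ _ _) = _
        rw [exchange_of_ne _ _ hk.1 hk.2]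
    have hc : P.next.SameCycle x.1 (μ (Z.origin x.1)) :=
      (P.sameCycle_next_iff _ _).2 (hμ.origin_eq _).symm
    obtain ⟨k, hk⟩ := hc.exists_nat_pow_eq
    rw [← key] at hk
    refine hx ((π ^ k) x) ?_ ⟨k, by simp⟩
    rw [hT, hk]
    exact Or.inl (hμ.mem _)
  · intro t ht t' ht' htt'
    obtain ⟨k, rfl⟩ := htt'.exists_nat_pow_eq
    rw [hT] at ht ht'
    exact Subtype.ext (hh.eq_of_origin_eq hμ hμ' (hπo k t).symm ht ht'
      (t.2.trans ((π ^ k) t).2.symm))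

/-- Two steps run from black `i` along `m` to white `σ i`, then back along `m'` to black `σ'⁻¹ (σ
i)`. Starting from an `m'`-dart gives the inverse permutation. -/
theorem exchange_reversal_inl (hμ : Z.IsMatchingDart m μ) (hμ' : Z.IsMatchingDart m' μ')
    {σ σ' : Equiv.Perm (Fin n)} (hσ : ∀ e ∈ m, Z.white e = σ (Z.black e))
    (hσ' : ∀ e ∈ m', Z.white e = σ' (Z.black e)) (i : Fin n) :
    (exchange hμ.origin_eq hμ'.origin_eq * reversal E)
      ((exchange hμ.origin_eq hμ'.origin_eq * reversal E) (μ (Sum.inl i))) =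
        μ (Sum.inl (σ'.symm (σ i))) := by
  rw [Equiv.Perm.mul_apply, Equiv.Perm.mul_apply, hμ.reversal_inl hσ, exchange_left,
    hμ'.reversal_inr hσ', exchange_right]

theorem exchange_reversal_inl' (hμ : Z.IsMatchingDart m μ) (hμ' : Z.IsMatchingDart m' μ')
    {σ σ' : Equiv.Perm (Fin n)} (hσ : ∀ e ∈ m, Z.white e = σ (Z.black e))
    (hσ' : ∀ e ∈ m', Z.white e = σ' (Z.black e)) (i : Fin n) :
    (exchange hμ.origin_eq hμ'.origin_eq * reversal E)
      ((exchange hμ.origin_eq hμ'.origin_eq * reversal E) (μ' (Sum.inl i))) =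
        μ' (Sum.inl (σ.symm (σ' i))) := by
  rw [Equiv.Perm.mul_apply, Equiv.Perm.mul_apply, hμ'.reversal_inl hσ', exchange_right,
    hμ.reversal_inr hσ, exchange_left]

/-- The sign of the permutation that follows the boundary of the region and reverses the darts
elsewhere. -/
theorem sign_exchange_reversal [Fintype E] [DecidableEq E] (hh : IsBoundedRegion P m m' h)
    (hμ : Z.IsMatchingDart m μ) (hμ' : Z.IsMatchingDart m' μ')
    {σ σ' : Equiv.Perm (Fin n)} (hσ : ∀ e ∈ m, Z.white e = σ (Z.black e))
    (hσ' : ∀ e ∈ m', Z.white e = σ' (Z.black e)) :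
    Equiv.Perm.sign ((exchange hμ.origin_eq hμ'.origin_eq * reversal E).subtypePerm
      (p := fun d => h d = 1) fun d => by rw [hh.apply_exchange_reversal hμ hμ']) =
      (-1) ^ (Finset.univ.filter fun x : {d // h d = 1} => x.1.2 = false).card *
        (Equiv.Perm.sign σ * Equiv.Perm.sign σ') := by
  -- On black matching darts of the region, `c²` acts as `τ` where the `m`-dart is inside and as
  -- `τ⁻¹` where only the `m'`-dart is. The permutation `g` combines both without changing the sign.
  let S : Fin n → Prop := fun i => h (μ (Sum.inl i)) = 1
  let τ : Equiv.Perm (Fin n) := σ.trans σ'.symm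
  have two : ∀ a b : ZMod 2, a ≠ b → a ≠ 1 → b = 1 := by decide
  obtain ⟨g, hgS, hgS', hsign⟩ := Equiv.Perm.exists_perm_inverting τ S (fun i => by
    change h (μ (Sum.inl (σ'.symm (σ i)))) = 1 ↔ _
    rw [← exchange_reversal_inl hμ hμ' hσ hσ', hh.apply_exchange_reversal hμ hμ',
      hh.apply_exchange_reversal hμ hμ'])
  have hτ : Equiv.Perm.sign τ = Equiv.Perm.sign σ * Equiv.Perm.sign σ' := by
    rw [show τ = σ'⁻¹ * σ from rfl, Equiv.Perm.sign_mul, Equiv.Perm.sign_inv, mul_comm]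
  have hinl : ∀ x : Dart E, x.2 = false → Z.origin x = Sum.inl (Z.black x.1) := fun x hx => by
    simp [origin, hx]
  rw [← hτ, ← hsign]
  set c := (exchange hμ.origin_eq hμ'.origin_eq * reversal E).subtypePerm
      (p := fun d => h d = 1) fun d => by rw [hh.apply_exchange_reversal hμ hμ'] with hcdef
  have hcc : ∀ x, (c (c x)).1 = (exchange hμ.origin_eq hμ'.origin_eq * reversal E)
      ((exchange hμ.origin_eq hμ'.origin_eq * reversal E) x.1) := fun x => rfl
  have hmem : ∀ x, c (c x) ≠ x → x.1.1 ∈ m ∨ x.1.1 ∈ m' := by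
    intro x hx
    by_contra! hn
    have e1 : ∀ y : Dart E, y.1 = x.1.1 → exchange hμ.origin_eq hμ'.origin_eq y = y := by
      intro y hy
      refine exchange_of_ne _ _ ?_ ?_
      · rw [Ne, ← hμ.mem_iff, hy]; exact hn.1
      · rw [Ne, ← hμ'.mem_iff, hy]; exact hn.2
    apply hx
    apply Subtype.ext
    rw [hcc, Equiv.Perm.mul_apply _ _ x.1, e1 (reversal E x.1) rfl, Equiv.Perm.mul_apply,
      e1 (reversal E (reversal E x.1)) rfl]
    simp
  refine Equiv.Perm.sign_eq_of_interchange c (fun x => x.1.2)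
    (fun x => exchange_reversal_snd hμ hμ' x.1) g (fun x => Z.black x.1.1) ?_ ?_ ?_
  · intro x hx hne
    have ho := hinl _ hx
    by_cases hxm : x.1.1 ∈ m
    · have hx1 : x.1 = μ (Sum.inl (Z.black x.1.1)) := by rw [← ho]; exact (hμ.mem_iff _).1 hxm
      have hxS : S (Z.black x.1.1) := by
        change h (μ _) = 1
        rw [← hx1, x.2]
      rw [hgS _ hxS, hcc]
      conv_lhs => rw [hx1]
      rw [exchange_reversal_inl hμ hμ' hσ hσ', hμ.black_inl]
      rfl
    · have hxm' := (hmem x hne).resolve_left hxm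
      have hx1 : x.1 = μ' (Sum.inl (Z.black x.1.1)) := by rw [← ho]; exact (hμ'.mem_iff _).1 hxm'
      have hxS : ¬ S (Z.black x.1.1) := by
        intro hs
        apply hxm
        rw [hh.eq_of_origin_eq hμ hμ' (d' := μ (Sum.inl (Z.black x.1.1)))
          (by rw [ho, hμ.origin_eq]) (hmem x hne) (Or.inl (hμ.mem _)) (x.2.trans hs.symm)]
        exact hμ.mem _
      rw [hgS' _ hxS, hcc]
      conv_lhs => rw [hx1]
      rw [exchange_reversal_inl' hμ hμ' hσ hσ', hμ'.black_inl]
      rfl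
  · intro x y hx hy hnx hny hxy
    exact Subtype.ext (hh.eq_of_origin_eq hμ hμ' (by rw [hinl _ hx, hinl _ hy, hxy])
      (hmem x hnx) (hmem y hny) (x.2.trans y.2.symm))
  · intro i hi
    by_cases hS : S i
    · refine ⟨⟨μ (Sum.inl i), hS⟩, hμ.inl_snd i, fun he => hi ?_, hμ.black_inl i⟩
      have := congrArg Subtype.val he
      rw [hcc, exchange_reversal_inl hμ hμ' hσ hσ'] at this
      have := congrArg (fun d : Dart E => Z.black d.1) this
      simp only [hμ.black_inl] at this
      rw [hgS i hS]
      exact this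
    -- A dart shared by both matchings would make `τ` fix `i`.
    · have hne : μ (Sum.inl i) ≠ μ' (Sum.inl i) := by
        intro he
        apply hi
        have h1 := hσ _ (hμ.mem (Sum.inl i))
        have h2 := hσ' _ (hμ'.mem (Sum.inl i))
        rw [← he, h1, hμ.black_inl] at h2
        rw [hgS' i hS]
        change σ.symm (σ' i) = i
        rw [← h2, Equiv.symm_apply_apply]
      refine ⟨⟨μ' (Sum.inl i), two _ _ (hh.apply_ne hμ hμ' hne) hS⟩, hμ'.inl_snd i,
        fun he => hi ?_, hμ'.black_inl i⟩
      have := congrArg Subtype.val he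
      rw [hcc, exchange_reversal_inl' hμ hμ' hσ hσ'] at this
      have := congrArg (fun d : Dart E => Z.black d.1) this
      simp only [hμ'.black_inl] at this
      rw [hgS' i hS]
      exact this

/-- Edges with both sides in the region cancel. -/
theorem prod_sign_eq [Fintype E] [DecidableEq E] (hh : IsBoundedRegion P m m' h) (s : E → ℤˣ) :
    ∏ x : {d // h d = 1}, s x.1.1 = (∏ e ∈ m, s e) * ∏ e ∈ m', s e := by
  rw [← Finset.prod_subtype (Finset.univ.filter fun d => h d = 1) (by simp) fun d => s d.1,
    Finset.prod_filter, Fintype.prod_prod_type]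
  have hx : ∀ T : Finset E, ∏ e ∈ T, s e = ∏ e, if e ∈ T then s e else 1 := fun T => by
    rw [Finset.prod_ite_mem, Finset.univ_inter]
  rw [hx m, hx m', ← Finset.prod_mul_distrib]
  refine Finset.prod_congr rfl fun e _ => ?_
  have he := hh.edge (e, false)
  simp only [reversal_apply, Bool.not_false] at he
  rw [Fintype.prod_bool]
  have two : ∀ a : ZMod 2, a = 0 ∨ a = 1 := by decide
  have hs := Int.units_mul_self (s e)
  have h11 : (1 : ZMod 2) + 1 = 0 := rfl
  -- An edge has exactly one side in the region iff it lies in exactly one matching; otherwise both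
  -- products receive a square or `1`.
  rcases two (h (e, false)) with h0 | h0 <;> by_cases h1 : e ∈ m <;> by_cases h2 : e ∈ m' <;>
    simp [indicatorDiff, h0, h1, h2, h11] at he <;> simp [he, h0, h1, h2, hs]

end IsBoundedRegion

/-! ### Comparison of matchings, determinant and permanent -/

/-- In a flat signing all perfect matchings have the same sign. -/
theorem PlanarEmbedding.IsFlat.sign_mul_prod_eq [Fintype E] {P : Z.PlanarEmbedding} {s : E → ℤˣ}
    (hs : P.IsFlat s) {m m' : Finset E} (hm : Z.IsPerfectMatching m) (hm' : Z.IsPerfectMatching m')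
    {σ σ' : Equiv.Perm (Fin n)} (hσ : ∀ e ∈ m, Z.white e = σ (Z.black e))
    (hσ' : ∀ e ∈ m', Z.white e = σ' (Z.black e)) :
    Equiv.Perm.sign σ * ∏ e ∈ m, s e = Equiv.Perm.sign σ' * ∏ e ∈ m', s e := by
  classical
  obtain ⟨μ, hμ⟩ := hm.exists_isMatchingDart
  obtain ⟨μ', hμ'⟩ := hm'.exists_isMatchingDart
  obtain ⟨h, hh⟩ := P.exists_isBoundedRegion hm hm'
  let f := P.facePerm.subtypePerm (p := fun d => h d = 1) fun d => by rw [hh.face]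
  have hf : f = (P.next * exchange hμ.origin_eq hμ'.origin_eq).subtypePerm
      (p := fun d => h d = 1) (fun d => by rw [hh.apply_next_exchange hμ hμ']) *
      (exchange hμ.origin_eq hμ'.origin_eq * reversal E).subtypePerm
      (p := fun d => h d = 1) fun d => by rw [hh.apply_exchange_reversal hμ hμ'] := by
    ext1 x
    apply Subtype.ext
    change P.next _ = P.next (exchange hμ.origin_eq hμ'.origin_eq
      (exchange hμ.origin_eq hμ'.origin_eq (reversal E x.1)))
    rw [exchange_exchange]
  have h1 : Equiv.Perm.sign f = _ := congrArg Equiv.Perm.sign hf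
  rw [Equiv.Perm.sign_mul, hh.sign_next_exchange hμ hμ', one_mul,
    hh.sign_exchange_reversal hμ hμ' hσ hσ'] at h1
  have hcard := Equiv.Perm.card_eq_two_mul_card_filter f (fun x => x.1.2) (fun x => P.facePerm_snd x.1)
    Finset.univ (by simp)
  -- Cycles of `f` are entire faces, so flatness applies to each. The power of `-1` counting
  -- black-to-white darts occurs in both evaluations and cancels.
  rw [Equiv.Perm.sign_eq_of_prod_sameCycle f
    (fun x => s x.1.1 * if x.1.2 = false then -1 else 1) (fun x => by
      refine Eq.trans ?_ (hs.prod_face x.1)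
      refine Finset.prod_bij (fun y _ => y.1) ?_ (fun _ _ _ _ h => Subtype.ext h) ?_
        (fun _ _ => rfl)
      · intro y hy
        simpa [f] using hy
      · intro y hy
        have hy' : P.facePerm.SameCycle x.1 y := by simpa using hy
        obtain ⟨k, hk⟩ := hy'.exists_nat_pow_eq
        refine ⟨(f ^ k) x, Finset.mem_filter.2 ⟨Finset.mem_univ _, k, by simp⟩, ?_⟩
        rw [← hk]
        simp [f]),
    ← Finset.card_univ, hcard, pow_mul, neg_one_sq, one_pow, one_mul, Finset.prod_mul_distrib,
    ← Finset.prod_filter, Finset.prod_const, mul_comm, hh.prod_sign_eq, mul_right_inj] at h1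
  calc Equiv.Perm.sign σ * ∏ e ∈ m, s e
      = Equiv.Perm.sign σ * (∏ e ∈ m, s e) * ((∏ e ∈ m', s e) * ∏ e ∈ m', s e) := by
        rw [Int.units_mul_self, mul_one]
    _ = Equiv.Perm.sign σ * ((∏ e ∈ m, s e) * ∏ e ∈ m', s e) * ∏ e ∈ m', s e := by
        simp only [mul_assoc]
    _ = (Equiv.Perm.sign σ * Equiv.Perm.sign σ) * Equiv.Perm.sign σ' * ∏ e ∈ m', s e := by
        rw [h1]; simp only [mul_assoc]
    _ = _ := by rw [Int.units_mul_self, one_mul]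

/-- The product of entries of the adjacency matrix along a permutation, as a sum over choices of
edges. -/
theorem prod_adjMatrix [Fintype E] {R : Type*} [CommRing R] (Z : BipartiteGraph n E) (w : E → R)
    (σ : Equiv.Perm (Fin n)) [DecidableEq E] :
    ∏ i, Z.adjMatrix w (σ i) i =
      ∑ c ∈ Fintype.piFinset fun i => Finset.univ.filter fun e =>
        Z.black e = σ i ∧ Z.white e = i, ∏ i, w (c i) := by
  simp only [adjMatrix, Matrix.of_apply]
  rw [Finset.prod_univ_sum]

theorem isPerfectMatching_image [DecidableEq E] {c : Fin n → E} {σ : Equiv.Perm (Fin n)}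
    (hc : ∀ i, Z.black (c i) = σ i ∧ Z.white (c i) = i) :
    Z.IsPerfectMatching (Finset.univ.image c) := by
  refine ⟨fun i => ⟨c (σ.symm i), ⟨by simp, by simp [hc]⟩, ?_⟩, fun j => ⟨c j, by simp [hc], ?_⟩⟩
  · rintro e ⟨he, rfl⟩
    obtain ⟨j, -, rfl⟩ := Finset.mem_image.1 he
    simp [hc]
  · rintro e ⟨he, rfl⟩
    obtain ⟨j, -, rfl⟩ := Finset.mem_image.1 he
    simp [hc]

theorem prod_signedWeight [Fintype E] {R : Type*} [CommRing R] (s : E → ℤˣ) (w : E → R)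
    (c : Fin n → E) :
    ∏ i, signedWeight s w (c i) = (((∏ i, s (c i) : ℤˣ) : ℤ) : R) * ∏ i, w (c i) := by
  simp only [signedWeight, Finset.prod_mul_distrib, Units.coe_prod, Int.cast_prod]

end BipartiteGraph

theorem theorem2 {n : ℕ} {E : Type*} [Fintype E] (Z : BipartiteGraph n E)
    (P : Z.PlanarEmbedding) (s : E → ℤˣ) (hs : P.IsFlat s) :
    ∃ ε : ℤˣ,
      (∀ (R : Type*) [CommRing R] (w : E → R),
        (Z.adjMatrix (BipartiteGraph.signedWeight s w)).det =
          ((ε : ℤ) : R) * (Z.adjMatrix w).permanent) ∧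
      (∀ (m : Finset E) (σ : Equiv.Perm (Fin n)), Z.IsPerfectMatching m →
        (∀ e ∈ m, Z.white e = σ (Z.black e)) →
          Equiv.Perm.sign σ * ∏ e ∈ m, s e = ε) := by
  classical
  obtain ⟨ε, hε⟩ : ∃ ε : ℤˣ, ∀ (m : Finset E) (σ : Equiv.Perm (Fin n)), Z.IsPerfectMatching m →
      (∀ e ∈ m, Z.white e = σ (Z.black e)) → Equiv.Perm.sign σ * ∏ e ∈ m, s e = ε := by
    by_cases hex : ∃ (m : Finset E) (σ : Equiv.Perm (Fin n)), Z.IsPerfectMatching m ∧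
      ∀ e ∈ m, Z.white e = σ (Z.black e)
    · obtain ⟨m, σ, hm, hσ⟩ := hex
      exact ⟨_, fun m' σ' hm' hσ' => hs.sign_mul_prod_eq hm' hm hσ' hσ⟩
    -- Without a perfect matching both expansions are empty, so any sign serves.
    · exact ⟨1, fun m σ hm hσ => (hex ⟨m, σ, hm, hσ⟩).elim⟩
  refine ⟨ε, fun R _ w => ?_, hε⟩
  rw [Matrix.det_apply', Matrix.permanent, Finset.mul_sum]
  refine Finset.sum_congr rfl fun σ _ => ?_
  rw [BipartiteGraph.prod_adjMatrix, BipartiteGraph.prod_adjMatrix, Finset.mul_sum, Finset.mul_sum]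
  refine Finset.sum_congr rfl fun c hc => ?_
  have hc' : ∀ i, Z.black (c i) = σ i ∧ Z.white (c i) = i := by
    simpa [Fintype.mem_piFinset] using hc
  have hinj : Function.Injective c := fun i j hij => by
    rw [← (hc' i).2, hij, (hc' j).2]
  -- The expansion uses the entries `(σ i, i)`, so the matching sends black to white by `σ⁻¹`, which
  -- has the same sign.
  rw [BipartiteGraph.prod_signedWeight, ← mul_assoc, ← hε _ σ⁻¹
    (BipartiteGraph.isPerfectMatching_image hc') (by simp [hc']), Equiv.Perm.sign_inv,
    Finset.prod_image hinj.injOn]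
  push_cast
  rfl
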